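/- For a subgroup $N$ of a group and $n\ge 1$, let $N^{n}$ be the subgroup generated by the $n$-th powers of elements of $N$. Let $p$ be a prime. A normal subgroup $N$ of a finite $p$-group $P$ is powerfully embedded in $P$ if $[N,P]\le N^{2p}$. An $\eta$-series of $P$ is an ascending series $1=N_0\le N_1\le N_2\le\cdots$ of normal subgroups of $P$ such that $N_{i+1}/N_i$ is powerfully embedded in $P/N_i$ for all $i\ge 0$. The powerful class $\operatorname{pwc}(P)$ is the least $k\ge 0$ such that $P$ has an $\eta$-series with $N_k=P$; $P$ has small powerful class if $\operatorname{pwc}(P)<p$. For a finite group $H$, let $H'$ be its derived subgroup and $O^p(H)$ the smallest normal subgroup of $H$ whose quotient is a $p$-group. Proposition. Let $G$ be a finite group and $P$ a Sylow $p$-subgroup of $G$. If $P$ has small powerful class, then $N=N_G(P)$ controls transfer in $G$, that is, $P\cap G'=P\cap N'$ and $O^p(N)=N\cap O^p(G)$. -/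

import Mathlib

/-- `N ^ n`: the subgroup generated by the `n`-th powers of the elements of `N`. -/
def Subgroup.powSubgroup {P : Type*} [Group P] (N : Subgroup P) (n : ℕ) : Subgroup P :=
  Subgroup.closure ((fun x : P => x ^ n) '' (N : Set P))

/-- A normal subgroup `N` of a `p`-group `P` is powerfully embedded in `P` if
`[N, P] ≤ N ^ (2p)`. (For odd `p` this is `[N, P] ≤ N ^ p`; for `p = 2` it is `[N, P] ≤ N ^ 4`.) -/
def Subgroup.IsPowerfullyEmbedded (p : ℕ) {P : Type*} [Group P] (N : Subgroup P) : Prop :=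
  N.Normal ∧ ⁅N, (⊤ : Subgroup P)⁆ ≤ N.powSubgroup (2 * p)

/-- An `η`-series of `P`: an ascending series `1 = N 0 ≤ N 1 ≤ N 2 ≤ ⋯` of normal subgroups of `P`
such that `N (i + 1) / N i` is powerfully embedded in `P / N i` for all `i`. -/
structure IsEtaSeries (p : ℕ) {P : Type*} [Group P] (N : ℕ → Subgroup P) : Prop where
  zero : N 0 = ⊥
  mono : ∀ i, N i ≤ N (i + 1)
  normal : ∀ i, (N i).Normal
  powerfullyEmbedded : ∀ i, haveI := normal i
    ((N (i + 1)).map (QuotientGroup.mk' (N i))).IsPowerfullyEmbedded p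

/-- The powerful height of `N` in `P`: the least `k` such that `P` has an `η`-series whose `k`-th
term is `N` (and `⊤` if there is no such `k`, which does not happen for a normal subgroup of
a finite `p`-group). -/
noncomputable def powerfulHeight (p : ℕ) {P : Type*} [Group P] (N : Subgroup P) : ℕ∞ :=
  ⨅ (k : ℕ) (_ : ∃ s : ℕ → Subgroup P, IsEtaSeries p s ∧ s k = N), (k : ℕ∞)

/-- The powerful class `pwc P` of `P`: the powerful height of `P` in itself. -/
noncomputable def powerfulClass (p : ℕ) (P : Type*) [Group P] : ℕ∞ :=
  powerfulHeight p (⊤ : Subgroup P)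

/-- `P` has small powerful class if `pwc P < p`. -/
def HasSmallPowerfulClass (p : ℕ) (P : Type*) [Group P] : Prop :=
  powerfulClass p P < (p : ℕ∞)

/-- `O^p(G)`: the intersection of all normal subgroups of `G` whose quotient is a `p`-group. For
finite `G` it is the smallest such subgroup. -/
def pResidual (p : ℕ) (G : Type*) [Group G] : Subgroup G :=
  sInf {K : Subgroup G | ∃ _ : K.Normal, IsPGroup p (G ⧸ K)}

/-- A subgroup `N` of `G` containing the Sylow `p`-subgroup `P` controls transfer in `G` if
`P ∩ G' = P ∩ N'`, where the dash denotes the derived subgroup. -/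
def ControlsTransfer {p : ℕ} {G : Type*} [Group G] (P : Sylow p G) (N : Subgroup G) : Prop :=
  (P : Subgroup G) ≤ N ∧ (P : Subgroup G) ⊓ ⁅(⊤ : Subgroup G), ⊤⁆ = (P : Subgroup G) ⊓ ⁅N, N⁆

/-! Write `N = N_G(P)`. The core is that every homomorphism `f` from `N` to an abelian group of
exponent `p` is trivial on `N ∩ O^p(G)`. An argument in the style of Tate turns this into `N ∩
O^p(G) = O^p(N)`, and `P ∩ G' = P ∩ N'` follows because `G = N O^p(G)` gives `G' ≤ N' O^p(G)`.

The transfer of `f` to `G` kills `O^p(G)`. At `u ∈ P ∩ O^p(G)` it is a product over `G ⧸ N` in which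
the trivial coset contributes `f u`. The other cosets form nontrivial `P`-orbits, and each
contributes 1, by induction on the order of `u`. Indeed a point stabilizer lies in a normal subgroup
`T` of index `p` in `P`. If `u ∉ T`, then `u` fixes no point of the orbit, and its cycles involve
`f` only at conjugates of powers of `u` of smaller order. If `u ∈ T`, the contribution is a norm `∏
g (t⁻ⁱ u tⁱ)` with `g : T →* A`. In characteristic `p`, `1 + t + ⋯ + t^(p-1) = (t - 1)^(p-1)`, so
the norm vanishes once `T` lies in the `(p-1)`-st upper central term of `P` modulo the core `C` of
`ker g`.

Small powerful class enters only there: if `T` were not in that term, all terms of an `η`-series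
with index below `p` would be trapped in `T`, so none could be `P`
(`IsEtaSeries.le_relUpperCentralSeries`). -/

open scoped commutatorElement

/-! ### Upper central series modulo a normal subgroup, and `η`-series -/

/-- The preimage in `P` of the `i`-th term of the upper central series of `P ⧸ C`. -/
def Subgroup.relUpperCentralSeries {P : Type*} [Group P] (C : Subgroup P) [C.Normal] (i : ℕ) :
    Subgroup P :=
  (Subgroup.upperCentralSeries (P ⧸ C) i).comap (QuotientGroup.mk' C)

namespace Subgroup

variable {P : Type*} [Group P]

theorem relUpperCentralSeries_zero (C : Subgroup P) [C.Normal] :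
    C.relUpperCentralSeries 0 = C := by
  simp [relUpperCentralSeries, MonoidHom.comap_bot]

theorem mem_relUpperCentralSeries_succ {C : Subgroup P} [C.Normal] {i : ℕ} {x : P} :
    x ∈ C.relUpperCentralSeries (i + 1) ↔ ∀ y, ⁅x, y⁆ ∈ C.relUpperCentralSeries i := by
  simp only [relUpperCentralSeries, mem_comap, mem_upperCentralSeries_succ_iff, map_commutatorElement]
  exact (QuotientGroup.mk'_surjective C).forall

theorem relUpperCentralSeries_mono (C : Subgroup P) [C.Normal] :
    Monotone C.relUpperCentralSeries := fun _ _ h =>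
  comap_mono (upperCentralSeries_mono _ h)

theorem le_relUpperCentralSeries (C : Subgroup P) [C.Normal] (i : ℕ) :
    C ≤ C.relUpperCentralSeries i :=
  (relUpperCentralSeries_zero C).ge.trans (relUpperCentralSeries_mono C (Nat.zero_le i))

instance (C : Subgroup P) [C.Normal] (i : ℕ) : (C.relUpperCentralSeries i).Normal := by
  unfold relUpperCentralSeries; infer_instance

/-- A subgroup that properly contains a subgroup of prime index is the whole group. -/
theorem eq_top_of_le_of_prime_index {p : ℕ} (hp : p.Prime) {T S : Subgroup P} (hT : T.index = p)
    (hTS : T ≤ S) {y : P} (hy : y ∈ S) (hyT : y ∉ T) : S = ⊤ := by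
  have h := relIndex_mul_index hTS
  rw [hT] at h
  rcases (Nat.dvd_prime hp).1 ⟨_, h.symm⟩ with h1 | h1
  · exact absurd (relIndex_eq_one.1 h1 hy) hyT
  · rw [h1] at h
    exact index_eq_one.1 (Nat.eq_of_mul_eq_mul_left hp.pos (by simpa using h))

/-- If modulo the normal subgroup `Z` an element `a` commutes with a subgroup `T` of prime index
and with an element outside `T`, then it is central modulo `Z`. -/
theorem commutator_mem_of_prime_index {p : ℕ} (hp : p.Prime) {T Z : Subgroup P} [Z.Normal]
    (hT : T.index = p) {a y : P} (haT : ∀ b ∈ T, ⁅a, b⁆ ∈ Z) (hay : ⁅a, y⁆ ∈ Z) (hy : y ∉ T)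
    (z : P) : ⁅a, z⁆ ∈ Z := by
  have key : ∀ b, b ∈ (centralizer {(a : P ⧸ Z)}).comap (QuotientGroup.mk' Z) ↔ ⁅a, b⁆ ∈ Z := by
    intro b
    rw [mem_comap, mem_centralizer_singleton_iff, ← QuotientGroup.eq_one_iff ⁅a, b⁆]
    change _ ↔ QuotientGroup.mk' Z ⁅a, b⁆ = 1
    rw [map_commutatorElement, commutatorElement_eq_one_iff_mul_comm]
    exact eq_comm
  rw [← key, eq_top_of_le_of_prime_index hp hT (fun b hb => (key b).2 (haT b hb))
    ((key y).2 hay) hy]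
  trivial

end Subgroup

open Subgroup

/-- The defining condition of an `η`-series, in terms of elements. -/
theorem IsEtaSeries.commutator_mem {p : ℕ} {P : Type*} [Group P] {s : ℕ → Subgroup P}
    (hs : IsEtaSeries p s) {i : ℕ} {D : Subgroup P} (hD : s i ≤ D)
    (hpow : ∀ x ∈ s (i + 1), x ^ (2 * p) ∈ D) {n : P} (hn : n ∈ s (i + 1)) (y : P) :
    ⁅n, y⁆ ∈ D := by
  have := hs.normal i
  have h1 := (hs.powerfullyEmbedded i).2
  have h2 : ((s (i + 1)).map (QuotientGroup.mk' (s i))).powSubgroup (2 * p) ≤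
      D.map (QuotientGroup.mk' (s i)) := by
    refine (closure_le _).2 ?_
    rintro _ ⟨_, ⟨x, hx, rfl⟩, rfl⟩
    exact ⟨x ^ (2 * p), hpow x hx, map_pow _ _ _⟩
  have h3 := h2 (h1 (commutator_mem_commutator (mem_map_of_mem (QuotientGroup.mk' (s i)) hn)
    (mem_top (QuotientGroup.mk' (s i) y))))
  rw [← map_commutatorElement, ← mem_comap, comap_map_eq_self (by simpa using hD)] at h3
  exact h3

/-- Two facts drive the induction: `p`-th powers are central modulo `C`, and, since `T` is not in
level `p - 1`, any element of a level at most `p - 1` must lie in `T`. -/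
theorem IsEtaSeries.le_relUpperCentralSeries {p : ℕ} (hp : p.Prime) {P : Type*} [Group P]
    {s : ℕ → Subgroup P} (hs : IsEtaSeries p s) {T C : Subgroup P} [T.Normal] [C.Normal]
    (hcomm : ∀ a ∈ T, ∀ b ∈ T, ⁅a, b⁆ ∈ C) (hpow : ∀ a ∈ T, a ^ p ∈ C) (hT : T.index = p)
    (hTC : ¬ T ≤ C.relUpperCentralSeries (p - 1)) (i : ℕ) (hi : i < p) :
    s i ≤ T ⊓ C.relUpperCentralSeries i := by
  have hpowT : ∀ x, x ^ p ∈ T := fun x => hT ▸ T.pow_index_mem x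
  have hpow1 : ∀ x, x ^ p ∈ C.relUpperCentralSeries 1 := by
    intro x
    by_cases hx : x ∈ T
    · exact C.le_relUpperCentralSeries 1 (hpow x hx)
    -- For `x ∉ T`, the element `x ^ p` of `T` commutes modulo `C` with both `T` and `x`, which
    -- generate `P`.
    · refine mem_relUpperCentralSeries_succ.2 fun y => ?_
      rw [relUpperCentralSeries_zero]
      refine commutator_mem_of_prime_index hp hT (hcomm _ (hpowT x)) ?_ hx y
      rw [commutatorElement_eq_one_iff_mul_comm.2 (pow_mul_comm' x p)]
      exact one_mem C
  -- If `y ∉ T` had level `j + 1`, every `a ∈ T` would commute with `T` and `y` modulo level `j`,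
  -- forcing `T` into level `p - 1`.
  have hB : ∀ j, j + 1 ≤ p - 1 → ∀ y, (∀ z, ⁅y, z⁆ ∈ C.relUpperCentralSeries j) → y ∈ T := by
    intro j hj y hy
    by_contra hyT
    refine hTC (le_trans ?_ (C.relUpperCentralSeries_mono hj))
    intro a ha
    refine mem_relUpperCentralSeries_succ.2 fun z => ?_
    refine commutator_mem_of_prime_index hp hT
      (fun b hb => C.le_relUpperCentralSeries j (hcomm a ha b hb)) ?_ hyT z
    rw [← commutatorElement_inv]
    exact inv_mem (hy a)
  induction i with
  | zero => rw [hs.zero]; exact bot_le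
  | succ i ih =>
    have ih := ih (by omega)
    have hpow2 : ∀ x, ∀ j, 1 ≤ j → x ^ (2 * p) ∈ C.relUpperCentralSeries j := by
      intro x j hj
      rw [mul_comm, pow_mul]
      exact pow_mem (C.relUpperCentralSeries_mono hj (hpow1 x)) 2
    have hNT : s (i + 1) ≤ T := by
      intro y hy
      -- Until `s (i + 1) ≤ T` is known, `2p`-th powers are only placed in level 1, hence the level
      -- `max i 1`. The bound `max i 1 + 1 ≤ p - 1` fails only for `p = 2`, `i = 0`; there `x ^ 4 =
      -- (x ^ 2) ^ 2 ∈ C` because `x ^ 2 ∈ T`. This uses the exponent `2p`.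
      by_cases h2 : p = 2 ∧ i = 0
      · obtain ⟨rfl, rfl⟩ := h2
        refine hB 0 (by norm_num) y (hs.commutator_mem (hs.zero.trans_le bot_le) ?_ hy)
        intro x _
        rw [relUpperCentralSeries_zero, pow_mul]
        exact hpow _ (hpowT x)
      · have := hp.two_le
        refine hB (max i 1) (by omega) y (hs.commutator_mem
          (ih.trans (inf_le_right.trans (C.relUpperCentralSeries_mono (le_max_left i 1)))) ?_ hy)
        exact fun x _ => hpow2 x _ (le_max_right _ _)
    refine le_inf hNT fun n hn => mem_relUpperCentralSeries_succ.2 fun y =>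
      hs.commutator_mem (ih.trans inf_le_right) (fun x hx => ?_) hn y
    rw [mul_comm, pow_mul]
    exact pow_mem (C.le_relUpperCentralSeries i (hpow x (hNT hx))) 2

theorem HasSmallPowerfulClass.exists_isEtaSeries {p : ℕ} {P : Type*} [Group P]
    (h : HasSmallPowerfulClass p P) : ∃ k < p, ∃ s : ℕ → Subgroup P, IsEtaSeries p s ∧ s k = ⊤ := by
  unfold HasSmallPowerfulClass powerfulClass powerfulHeight at h
  simp only [iInf_lt_iff] at h
  obtain ⟨k, hk, hkp⟩ := h
  exact ⟨k, by exact_mod_cast hkp, hk⟩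

theorem HasSmallPowerfulClass.le_relUpperCentralSeries {p : ℕ} (hp : p.Prime) {P : Type*} [Group P]
    (h : HasSmallPowerfulClass p P) {T C : Subgroup P} [T.Normal] [C.Normal]
    (hcomm : ∀ a ∈ T, ∀ b ∈ T, ⁅a, b⁆ ∈ C) (hpow : ∀ a ∈ T, a ^ p ∈ C) (hT : T.index = p) :
    T ≤ C.relUpperCentralSeries (p - 1) := by
  by_contra hTC
  obtain ⟨k, hk, s, hs, hsk⟩ := h.exists_isEtaSeries
  have h1 := (hs.le_relUpperCentralSeries hp hcomm hpow hT hTC k hk).trans inf_le_left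
  rw [hsk, top_le_iff] at h1
  rw [h1, index_top] at hT
  exact hp.one_lt.ne hT

/-! ### The geometric sum in characteristic `p` -/

open Polynomial in
-- Modulo `p`, cancel `X - 1` in `X ^ p - 1 = (X - 1) ^ p`. The integral form can be evaluated in
-- any ring, commutative or not.
theorem Polynomial.exists_geom_sum_eq_sub_one_pow_add (p : ℕ) [Fact p.Prime] :
    ∃ q : ℤ[X], ∑ i ∈ Finset.range p, (X : ℤ[X]) ^ i = (X - 1) ^ (p - 1) + C (p : ℤ) * q := by
  have h : (∑ i ∈ Finset.range p, (X : (ZMod p)[X]) ^ i) = (X - 1) ^ (p - 1) := by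
    have h1 := geom_sum_mul (X : (ZMod p)[X]) p
    have h2 : (X - 1 : (ZMod p)[X]) ^ p = X ^ p - 1 := by rw [sub_pow_char, one_pow]
    have h0 : (X - 1 : (ZMod p)[X]) ≠ 0 := by simpa using X_sub_C_ne_zero (1 : ZMod p)
    rw [← h2, ← pow_sub_one_mul (Fact.out : p.Prime).ne_zero] at h1
    exact mul_right_cancel₀ h0 h1
  have h3 : C (p : ℤ) ∣ (∑ i ∈ Finset.range p, (X : ℤ[X]) ^ i) - (X - 1) ^ (p - 1) := by
    rw [C_dvd_iff_dvd_coeff]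
    intro i
    rw [← ZMod.intCast_zmod_eq_zero_iff_dvd, ← eq_intCast (Int.castRingHom (ZMod p)), ← coeff_map]
    simp [Polynomial.map_sum, h]
  obtain ⟨q, hq⟩ := h3
  exact ⟨q, by rw [← hq]; ring⟩

theorem geom_sum_eq_sub_one_pow {R : Type*} [Ring R] (p : ℕ) [Fact p.Prime] (hR : (p : R) = 0)
    (a : R) : ∑ i ∈ Finset.range p, a ^ i = (a - 1) ^ (p - 1) := by
  obtain ⟨q, hq⟩ := Polynomial.exists_geom_sum_eq_sub_one_pow_add p
  simpa [hR] using congrArg (Polynomial.aeval a) hq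

/-! ### Norms of homomorphisms from a subgroup of index `p` -/

section Norm

variable {P : Type*} [Group P] {T : Subgroup P} [T.Normal] {A : Type*} [CommGroup A]

/-- The action of `t` by conjugation on the homomorphisms from a normal subgroup. -/
def conjHomEnd (T : Subgroup P) [T.Normal] (A : Type*) [CommGroup A] (t : P) :
    AddMonoid.End (Additive (T →* A)) :=
  MonoidHom.toAdditive (MonoidHom.compHom' (MulAut.conjNormal t⁻¹ : MulAut T).toMonoidHom)

theorem conjHomEnd_apply (t : P) (g : Additive (T →* A)) (x : T) :
    (conjHomEnd T A t g).toMul x = g.toMul (MulAut.conjNormal t⁻¹ x) := rfl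

theorem conjHomEnd_pow_apply (t : P) (g : Additive (T →* A)) (i : ℕ) (x : T) :
    ((conjHomEnd T A t ^ i) g).toMul x = g.toMul (MulAut.conjNormal (t ^ i)⁻¹ x) := by
  induction i generalizing g with
  | zero => simp
  | succ i ih =>
    rw [pow_succ]
    change ((conjHomEnd T A t ^ i) (conjHomEnd T A t g)).toMul x = _
    rw [ih, conjHomEnd_apply, ← MulAut.mul_apply, ← map_mul, ← mul_inv_rev, ← pow_succ]

/-- Applying `t - 1` to `h` gives `x ↦ h ⁅t⁻¹, x⁆`, and the commutator lies one level lower. -/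
theorem conjHomEnd_sub_one_pow_apply (t : P) (g : T →* A) {C : Subgroup P} [C.Normal]
    (hg : ∀ x : T, (x : P) ∈ C → g x = 1) (i : ℕ) (x : T)
    (hx : (x : P) ∈ C.relUpperCentralSeries i) :
    (((conjHomEnd T A t - 1) ^ i) (Additive.ofMul g)).toMul x = 1 := by
  induction i generalizing x with
  | zero =>
    rw [relUpperCentralSeries_zero] at hx
    simpa using hg x hx
  | succ i ih =>
    rw [pow_succ']
    set h := ((conjHomEnd T A t - 1) ^ i) (Additive.ofMul g) with hh
    change (conjHomEnd T A t h).toMul x / h.toMul x = 1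
    rw [conjHomEnd_apply, ← map_div]
    apply ih
    have h1 := mem_relUpperCentralSeries_succ.1 hx t⁻¹
    rw [← commutatorElement_inv, inv_mem_iff] at h1
    simpa [commutatorElement_def, div_eq_mul_inv] using h1

/-- In a `p`-group of small powerful class, a homomorphism from a normal subgroup of index `p` to
an abelian group of exponent `p` has trivial norm. -/
theorem HasSmallPowerfulClass.prod_conj_eq_one {p : ℕ} [Fact p.Prime]
    (h : HasSmallPowerfulClass p P) (hA : ∀ a : A, a ^ p = 1) (hT : T.index = p) (g : T →* A)
    (t : P) (x : T) : ∏ i ∈ Finset.range p, g (MulAut.conjNormal (t ^ i)⁻¹ x) = 1 := by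
  -- The elements of `T` all of whose conjugates are killed by `g`: thus `T ⧸ C` embeds in a power
  -- of `A` and is elementary abelian.
  set C : Subgroup P := (g.ker.map T.subtype).normalCore with hC
  have hmem : ∀ a ∈ T, a ∈ C ↔ ∀ y : P, ∀ h : y * a * y⁻¹ ∈ T, g ⟨y * a * y⁻¹, h⟩ = 1 := by
    intro a ha
    refine forall_congr' fun y => ?_
    constructor
    · rintro ⟨b, hb, hba⟩ _
      have : b = ⟨y * a * y⁻¹, ‹_›⟩ := Subtype.ext hba
      exact this ▸ hb
    · intro h
      exact ⟨⟨_, (inferInstance : T.Normal).conj_mem a ha y⟩, h _, rfl⟩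
  have hcomm : ∀ a ∈ T, ∀ b ∈ T, ⁅a, b⁆ ∈ C := by
    intro a ha b hb
    have hab : ⁅a, b⁆ ∈ T := mul_mem (mul_mem (mul_mem ha hb) (inv_mem ha)) (inv_mem hb)
    refine (hmem _ hab).2 fun y hy => ?_
    have : (⟨y * ⁅a, b⁆ * y⁻¹, hy⟩ : T) = ⁅(⟨y * a * y⁻¹, (inferInstance : T.Normal).conj_mem a ha y⟩ : T),
        ⟨y * b * y⁻¹, (inferInstance : T.Normal).conj_mem b hb y⟩⁆ := by
      apply Subtype.ext
      simp [commutatorElement_def, mul_assoc]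
    rw [this, map_commutatorElement, commutatorElement_eq_one_iff_mul_comm, mul_comm]
  have hpow : ∀ a ∈ T, a ^ p ∈ C := by
    intro a ha
    refine (hmem _ (pow_mem ha p)).2 fun y hy => ?_
    have : (⟨y * a ^ p * y⁻¹, hy⟩ : T) =
        (⟨y * a * y⁻¹, (inferInstance : T.Normal).conj_mem a ha y⟩ : T) ^ p := by
      apply Subtype.ext
      simp
    rw [this, map_pow, hA]
  have hgC : ∀ y : T, (y : P) ∈ C → g y = 1 := by
    intro y hy
    have := (hmem y y.2).1 hy 1 (by simp)
    simpa using this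
  have hTC := h.le_relUpperCentralSeries Fact.out hcomm hpow hT
  have h1 := conjHomEnd_sub_one_pow_apply t g hgC (p - 1) x (hTC x.2)
  have hR : ((p : ℕ) : AddMonoid.End (Additive (T →* A))) = 0 := by
    exact AddMonoidHom.ext fun f => (AddMonoid.End.natCast_apply p f).trans
      (Additive.toMul.injective (MonoidHom.ext fun y => hA (f.toMul y)))
  rw [← geom_sum_eq_sub_one_pow p hR] at h1
  have h2 : (∑ i ∈ Finset.range p, conjHomEnd T A t ^ i) (Additive.ofMul g) =
      ∑ i ∈ Finset.range p, (conjHomEnd T A t ^ i) (Additive.ofMul g) :=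
    AddMonoidHom.finsetSum_apply _ _ _
  rw [← h1, h2, toMul_sum, MonoidHom.finsetProd_apply]
  exact Finset.prod_congr rfl fun i _ => (conjHomEnd_pow_apply t _ i x).symm

end Norm

/-! ### Products of cocycles over orbits -/

section Cocycle

open MulAction

variable {H : Type*} [Group H] {Ω : Type*} [MulAction H Ω] {A : Type*} [CommGroup A]

theorem Finset.prod_smul_eq_of_forall_mem {T : Subgroup H} {Z : Finset Ω}
    (hZ : ∀ a ∈ T, ∀ y ∈ Z, a • y ∈ Z) {b : H} (hb : b ∈ T) (f : Ω → A) :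
    ∏ y ∈ Z, f (b • y) = ∏ y ∈ Z, f y :=
  Finset.prod_nbij' (b • ·) (b⁻¹ • ·) (hZ b hb) (hZ _ (inv_mem hb)) (by simp) (by simp) (by simp)

variable {c : H → Ω → A}

/-- The product of a cocycle over a finite invariant set is a homomorphism. -/
def cocycleProd (hc : ∀ a b x, c (a * b) x = c a (b • x) * c b x) (T : Subgroup H) (Z : Finset Ω)
    (hZ : ∀ a ∈ T, ∀ y ∈ Z, a • y ∈ Z) : T →* A where
  toFun a := ∏ y ∈ Z, c a y
  map_one' := Finset.prod_eq_one fun y _ => by simpa using hc 1 1 y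
  map_mul' a b := by
    simp only [Subgroup.coe_mul, hc, Finset.prod_mul_distrib]
    rw [Finset.prod_smul_eq_of_forall_mem hZ b.2 (c a)]

/-- Pointwise the two sides differ by a coboundary of `c t`, which cancels over an invariant set. -/
theorem prod_cocycle_smul (hc : ∀ a b x, c (a * b) x = c a (b • x) * c b x) {T : Subgroup H}
    {Z : Finset Ω} (hZ : ∀ a ∈ T, ∀ y ∈ Z, a • y ∈ Z) {u t : H} (hu : t⁻¹ * u * t ∈ T) :
    ∏ y ∈ Z, c u (t • y) = ∏ y ∈ Z, c (t⁻¹ * u * t) y := by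
  have h : ∀ y, c u (t • y) * c t y = c t ((t⁻¹ * u * t) • y) * c (t⁻¹ * u * t) y := by
    intro y
    rw [← hc, ← hc]
    congr 1
    group
  have h1 := Finset.prod_congr (rfl : Z = Z) fun y _ => h y
  rw [Finset.prod_mul_distrib, Finset.prod_mul_distrib,
    Finset.prod_smul_eq_of_forall_mem hZ hu (c t), mul_comm] at h1
  exact mul_left_cancel h1

theorem cocycle_pow (hc : ∀ a b x, c (a * b) x = c a (b • x) * c b x) (u : H) (x : Ω) (m : ℕ) :
    c (u ^ m) x = ∏ i ∈ Finset.range m, c u (u ^ i • x) := by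
  induction m with
  | zero => simpa using hc 1 1 x
  | succ m ih => rw [pow_succ', hc, Finset.prod_range_succ, ih, mul_comm]

/-- Over one cycle of `u`, of length `m`, the factors multiply to `c (u ^ m) y`. -/
theorem prod_cocycle_eq_one_of_period [Finite H] (hc : ∀ a b x, c (a * b) x = c a (b • x) * c b x)
    {u : H} {Z : Finset Ω} (hZ : ∀ y ∈ Z, u • y ∈ Z)
    (hu : ∀ y ∈ Z, c (u ^ Function.minimalPeriod (u • ·) y) y = 1) : ∏ y ∈ Z, c u y = 1 := by
  classical
  refine Finset.prod_cancels_of_partition_cancels (orbitRel (Subgroup.zpowers u) Ω) fun x hx => ?_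
  rw [← hu x hx, cocycle_pow hc]
  have hpow : ∀ i : ℕ, u ^ i • x ∈ Z := by
    intro i
    induction i with
    | zero => simpa using hx
    | succ i ih => rw [pow_succ', mul_smul]; exact hZ _ ih
  symm
  refine Finset.prod_bij (fun i _ => u ^ i • x) ?_ ?_ ?_ (fun _ _ => rfl)
  · intro i _
    rw [Finset.mem_filter]
    exact ⟨hpow i, ⟨⟨u ^ i, Subgroup.npow_mem_zpowers u i⟩, rfl⟩⟩
  · intro i hi j hj hij
    have := Function.iterate_injOn_Iio_minimalPeriod (f := (u • · : Ω → Ω)) (x := x)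
      (x₁ := i) (x₂ := j) (Finset.mem_range.1 hi) (Finset.mem_range.1 hj)
    simp only [smul_iterate] at this
    exact this hij
  · intro y hy
    obtain ⟨_, ⟨v, hv⟩, hvy⟩ := Finset.mem_filter.1 hy
    obtain ⟨k, hk⟩ := mem_powers_iff_mem_zpowers.2 hv
    have hpos : 0 < Function.minimalPeriod (u • ·) x := by
      rw [Function.minimalPeriod_pos_iff_mem_periodicPts]
      exact ⟨orderOf u, orderOf_pos u, by
        simp [Function.IsPeriodicPt, Function.IsFixedPt, smul_iterate, pow_orderOf_eq_one]⟩
    refine ⟨k % Function.minimalPeriod (u • ·) x, Finset.mem_range.2 (Nat.mod_lt _ hpos), ?_⟩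
    rw [pow_smul_mod_minimalPeriod, ← hvy]
    change u ^ k • x = v • x
    rw [← hk]

/-- A proper subgroup of a finite `p`-group lies in a normal subgroup of index `p`. -/
theorem IsPGroup.exists_le_normal_index_eq [Finite H] {p : ℕ} [Fact p.Prime] (hH : IsPGroup p H)
    {R : Subgroup H} (hR : R ≠ ⊤) : ∃ T : Subgroup H, R ≤ T ∧ T.Normal ∧ T.index = p := by
  have hp : p.Prime := Fact.out
  obtain ⟨a, ha⟩ := IsPGroup.iff_card.1 hH
  obtain ⟨n, hn⟩ := IsPGroup.iff_card.1 (hH.to_subgroup R)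
  have hna : n < a := by
    have h1 : Nat.card R < Nat.card H :=
      lt_of_le_of_ne (Subgroup.card_le_card_group R) fun h => hR (Subgroup.eq_top_of_card_eq R h)
    rw [ha, hn] at h1
    exact (Nat.pow_lt_pow_iff_right hp.one_lt).1 h1
  obtain ⟨T, hT, hRT⟩ := Sylow.exists_subgroup_card_pow_prime_le p
    (ha ▸ pow_dvd_pow p (Nat.sub_le a 1)) R hn (Nat.le_sub_one_of_lt hna)
  have hidx : T.index = p := by
    have h1 := T.card_mul_index
    rw [hT, ha, ← pow_sub_one_mul (by omega : a ≠ 0)] at h1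
    exact Nat.eq_of_mul_eq_mul_left (pow_pos hp.pos _) h1
  refine ⟨T, hRT, ?_, hidx⟩
  apply Subgroup.normal_of_index_eq_minFac_card
  rw [hidx, ha, hp.pow_minFac (by omega)]

/-- The product of a cocycle with values of exponent `p` over a nontrivial orbit of a `p`-group of
small powerful class is trivial at `u`, if this holds for the nontrivial orbits of `u` in it. -/
theorem HasSmallPowerfulClass.prod_cocycle_orbit_eq_one [Finite H] {p : ℕ} [Fact p.Prime]
    (h : HasSmallPowerfulClass p H) (hH : IsPGroup p H) (hA : ∀ a : A, a ^ p = 1)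
    (hc : ∀ a b x, c (a * b) x = c a (b • x) * c b x) {x : Ω} (hx : stabilizer H x ≠ ⊤)
    {Z : Finset Ω} (hZ : ∀ y, y ∈ Z ↔ y ∈ orbit H x) {u : H}
    (hu : ∀ y ∈ Z, u • y ≠ y → c (u ^ Function.minimalPeriod (u • ·) y) y = 1) :
    ∏ y ∈ Z, c u y = 1 := by
  classical
  have hp : p.Prime := Fact.out
  obtain ⟨T, hRT, hTn, hT⟩ := hH.exists_le_normal_index_eq hx
  have hZs : ∀ a : H, ∀ y ∈ Z, a • y ∈ Z := fun a y hy =>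
    (hZ _).2 (mem_orbit_of_mem_orbit a ((hZ y).1 hy))
  -- If `u ∉ T`, it fixes no point of the orbit: all point stabilizers are conjugate to one inside
  -- the normal subgroup `T`.
  by_cases huT : u ∈ T
  swap
  · refine prod_cocycle_eq_one_of_period hc (hZs u) fun y hy => hu y hy fun huy => huT ?_
    obtain ⟨b, rfl⟩ := (hZ y).1 hy
    have h1 : b⁻¹ * u * b ∈ T := hRT (by
      rw [mem_stabilizer_iff, mul_smul, mul_smul]
      exact inv_smul_eq_iff.2 huy)
    have := hTn.conj_mem _ h1 b
    simpa [mul_assoc] using this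
  obtain ⟨t, ht⟩ : ∃ t, t ∉ T := by
    by_contra! hall
    rw [(Subgroup.eq_top_iff' T).2 hall, Subgroup.index_top] at hT
    exact hp.one_lt.ne hT
  set Z₀ : Finset Ω := Z.filter (· ∈ orbit T x) with hZ₀
  have hmem : ∀ y, y ∈ Z₀ ↔ ∃ a ∈ T, a • x = y := by
    intro y
    rw [hZ₀, Finset.mem_filter]
    constructor
    · rintro ⟨_, a, ha⟩
      exact ⟨a, a.2, ha⟩
    · rintro ⟨a, ha, rfl⟩
      exact ⟨(hZ _).2 ⟨a, rfl⟩, ⟨⟨a, ha⟩, rfl⟩⟩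
  have hZ₀s : ∀ a ∈ T, ∀ y ∈ Z₀, a • y ∈ Z₀ := by
    intro a ha y hy
    obtain ⟨b, hb, rfl⟩ := (hmem y).1 hy
    exact (hmem _).2 ⟨a * b, mul_mem ha hb, mul_smul _ _ _⟩
  have hcard : Nat.card (H ⧸ T) = p := hT
  have htT : (t : H ⧸ T) ≠ 1 := fun h1 => ht ((QuotientGroup.eq_one_iff t).1 h1)
  have hord : orderOf (t : H ⧸ T) = p := by
    rcases (Nat.dvd_prime hp).1 (hcard ▸ orderOf_dvd_natCard (t : H ⧸ T)) with h1 | h1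
    · exact absurd (orderOf_eq_one_iff.1 h1) htT
    · exact h1
  -- Since the stabilizer of `x` lies in `T`, the orbit is the disjoint union of the `p` translates
  -- `t ^ i • Z₀` of a `T`-orbit.
  have hsum : ∏ y ∈ Z, c u y = ∏ i ∈ Finset.range p, ∏ y ∈ Z₀, c u (t ^ i • y) := by
    rw [← Finset.prod_product']
    symm
    refine Finset.prod_bij (fun q _ => t ^ q.1 • q.2) ?_ ?_ ?_ (fun _ _ => rfl)
    · rintro ⟨i, y⟩ hq
      exact hZs _ _ (Finset.mem_filter.1 (Finset.mem_product.1 hq).2).1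
    · rintro ⟨i, y⟩ hq ⟨j, z⟩ hq' heq
      simp only [Finset.mem_product, Finset.mem_range] at hq hq' heq
      obtain ⟨a, ha, rfl⟩ := (hmem y).1 hq.2
      obtain ⟨b, hb, rfl⟩ := (hmem z).1 hq'.2
      have h1 : (t ^ i * a)⁻¹ * (t ^ j * b) ∈ T := hRT (by
        rw [mem_stabilizer_iff, mul_smul, mul_smul, ← heq, ← mul_smul (t ^ i), inv_smul_smul])
      have h2 : ((t : H ⧸ T)) ^ i = (t : H ⧸ T) ^ j := by
        have h3 := QuotientGroup.eq.2 h1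
        simpa [QuotientGroup.mk_mul, (QuotientGroup.eq_one_iff a).2 ha,
          (QuotientGroup.eq_one_iff b).2 hb] using h3
      have h3 : i = j := pow_injOn_Iio_orderOf (by simpa [hord] using hq.1)
        (by simpa [hord] using hq'.1) h2
      subst h3
      rw [smul_left_cancel_iff] at heq
      rw [heq]
    · intro y hy
      obtain ⟨b, rfl⟩ := (hZ y).1 hy
      have h1 : (b : H ⧸ T) ∈ Subgroup.zpowers (t : H ⧸ T) := by
        rw [zpowers_eq_top_of_prime_card hcard htT]
        trivial
      obtain ⟨k, hk⟩ := mem_powers_iff_mem_zpowers.2 h1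
      have h2 : (t : H ⧸ T) ^ (k % p) = b := by
        rw [← hord, pow_mod_orderOf]
        exact hk
      refine ⟨(k % p, ((t ^ (k % p))⁻¹ * b) • x), ?_, ?_⟩
      · rw [Finset.mem_product]
        refine ⟨Finset.mem_range.2 (Nat.mod_lt _ hp.pos), (hmem _).2 ⟨_, ?_, rfl⟩⟩
        exact QuotientGroup.eq.1 (by simpa using h2)
      · simp [← mul_smul]
  have hconj : ∀ i : ℕ, (t ^ i)⁻¹ * u * t ^ i ∈ T := fun i => by
    simpa using hTn.conj_mem u huT (t ^ i)⁻¹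
  rw [hsum, ← h.prod_conj_eq_one hA hT (cocycleProd hc T Z₀ hZ₀s) t ⟨u, huT⟩]
  refine Finset.prod_congr rfl fun i _ => ?_
  rw [prod_cocycle_smul hc hZ₀s (hconj i)]
  simp only [cocycleProd, MonoidHom.coe_mk, OneHom.coe_mk, MulAut.conjNormal_apply, inv_inv]

end Cocycle

theorem orderOf_mul_mul_inv {G : Type*} [Group G] (g x : G) : orderOf (g * x * g⁻¹) = orderOf x :=
  (SemiconjBy.orderOf_eq g (by simp [SemiconjBy])).symm

theorem orderOf_inv_mul_mul {G : Type*} [Group G] (g x : G) : orderOf (g⁻¹ * x * g) = orderOf x := by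
  simpa using orderOf_mul_mul_inv g⁻¹ x

/-! ### The subgroup `O^p(G)` -/

section PResidual

variable {p : ℕ} [Fact p.Prime] {G : Type*} [Group G]

instance pResidual_normal : (pResidual p G).Normal := by
  refine ⟨fun n hn g => ?_⟩
  rw [pResidual, Subgroup.mem_sInf] at hn ⊢
  rintro K ⟨hK, hKp⟩
  exact hK.conj_mem n (hn K ⟨hK, hKp⟩) g

theorem IsPGroup.eq_one_of_coprime (hG : IsPGroup p G) {x : G} {n : ℕ} (hn : n.Coprime p)
    (hx : x ^ n = 1) : x = 1 := by
  obtain ⟨k, hk⟩ := IsPGroup.iff_orderOf.1 hG x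
  have h1 := orderOf_dvd_of_pow_eq_one hx
  have h2 := Nat.Coprime.eq_one_of_dvd (hk ▸ (hn.pow_right k).symm) h1
  exact orderOf_eq_one_iff.1 h2

theorem mem_pResidual_of_coprime {x : G} (hx : (orderOf x).Coprime p) : x ∈ pResidual p G := by
  rw [pResidual, Subgroup.mem_sInf]
  rintro K ⟨hK, hKp⟩
  refine (QuotientGroup.eq_one_iff x).1 (hKp.eq_one_of_coprime hx ?_)
  rw [← QuotientGroup.mk_pow, pow_orderOf_eq_one, QuotientGroup.mk_one]

theorem isPGroup_quotient_of_coprime_mem [Finite G] {K : Subgroup G} [K.Normal]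
    (hK : ∀ x : G, (orderOf x).Coprime p → x ∈ K) : IsPGroup p (G ⧸ K) := by
  intro x
  obtain ⟨g, rfl⟩ := QuotientGroup.mk_surjective x
  obtain ⟨k, m, hm, hkm⟩ := Nat.exists_eq_pow_mul_and_not_dvd (orderOf_pos g).ne' p
    (Fact.out : p.Prime).ne_one
  refine ⟨k, ?_⟩
  rw [← QuotientGroup.mk_pow, QuotientGroup.eq_one_iff]
  apply hK
  rw [orderOf_pow_of_dvd (pow_ne_zero k (Fact.out : p.Prime).ne_zero) (hkm ▸ dvd_mul_right _ _),
    hkm, Nat.mul_div_cancel_left _ (pow_pos (Fact.out : p.Prime).pos k)]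
  exact ((Nat.Prime.coprime_iff_not_dvd Fact.out).2 hm).symm

theorem isPGroup_quotient_pResidual [Finite G] : IsPGroup p (G ⧸ pResidual p G) :=
  isPGroup_quotient_of_coprime_mem fun _ => mem_pResidual_of_coprime

theorem pResidual_le {p : ℕ} {G : Type*} [Group G] {K : Subgroup G} [hK : K.Normal] (h : IsPGroup p (G ⧸ K)) :
    pResidual p G ≤ K :=
  sInf_le ⟨hK, h⟩

theorem pResidual_eq_closure [Finite G] :
    pResidual p G = Subgroup.closure {x : G | (orderOf x).Coprime p} := by
  apply le_antisymm
  · have : (Subgroup.closure {x : G | (orderOf x).Coprime p}).Normal :=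
      ⟨fun n hn g => (Subgroup.closure_le ((Subgroup.closure _).comap
        (MulAut.conj g).toMonoidHom)).2 (fun x hx => Subgroup.subset_closure (by
          change (orderOf (g * x * g⁻¹)).Coprime p
          rwa [orderOf_mul_mul_inv])) hn⟩
    exact pResidual_le (isPGroup_quotient_of_coprime_mem fun x hx => Subgroup.subset_closure hx)
  · exact (Subgroup.closure_le _).2 fun x hx => mem_pResidual_of_coprime hx

/-- `O^p(G)` has no nontrivial homomorphism to a `p`-group. -/
theorem map_pResidual_eq_one [Finite G] {B : Type*} [Group B] (hB : IsPGroup p B)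
    (f : pResidual p G →* B) (x : pResidual p G) : f x = 1 := by
  have h : pResidual p G ≤ f.ker.map (pResidual p G).subtype := by
    conv_lhs => rw [pResidual_eq_closure]
    refine (Subgroup.closure_le _).2 fun y hy => ?_
    refine ⟨⟨y, mem_pResidual_of_coprime hy⟩, ?_, rfl⟩
    refine hB.eq_one_of_coprime (n := orderOf y) hy ?_
    rw [← map_pow, ← map_one f]
    exact congrArg f (Subtype.ext (pow_orderOf_eq_one y))
  obtain ⟨y, hy, hyx⟩ := h x.2
  rw [← Subtype.ext hyx]
  exact hy

end PResidual

/-! ### Transfer from the normalizer -/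

section Control

variable {p : ℕ} [Fact p.Prime] {G : Type*} [Group G] [Finite G]

theorem Sylow.mem_of_orderOf_eq_pow {p : ℕ} {G : Type*} [Group G] (P : Sylow p G) {x : G}
    (hx : x ∈ Subgroup.normalizer (P : Set G)) {k : ℕ} (hk : orderOf x = p ^ k) : x ∈ P := by
  have h1 : IsPGroup p (Subgroup.zpowers x) :=
    IsPGroup.of_card (by rw [Nat.card_zpowers, hk])
  have h2 := h1.inf_normalizer_sylow P
  have h3 : x ∈ Subgroup.zpowers x ⊓ Subgroup.normalizer (P : Set G) :=
    ⟨Subgroup.mem_zpowers x, hx⟩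
  exact (h2 ▸ h3 : x ∈ Subgroup.zpowers x ⊓ P).2

/-- A Sylow subgroup `P` fixes only the trivial coset of its normalizer. -/
theorem Sylow.stabilizer_quotient_normalizer_ne_top (P : Sylow p G)
    {q : G ⧸ Subgroup.normalizer (P : Set G)} (hq : q ≠ ((1 : G) : G ⧸ _)) :
    MulAction.stabilizer (P : Subgroup G) q ≠ ⊤ := by
  intro h
  apply hq
  obtain ⟨x, rfl⟩ := QuotientGroup.mk_surjective q
  have h1 : ∀ a ∈ P, x⁻¹ * a * x ∈ P := by
    intro a ha
    have h2 : (⟨a, ha⟩ : (P : Subgroup G)) ∈ MulAction.stabilizer (P : Subgroup G)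
        (x : G ⧸ Subgroup.normalizer (P : Set G)) := h ▸ Subgroup.mem_top _
    have h3 : ((a * x : G) : G ⧸ Subgroup.normalizer (P : Set G)) = x := h2
    have h4 := QuotientGroup.eq.1 h3.symm
    obtain ⟨k, hk⟩ := IsPGroup.iff_orderOf.1 P.isPGroup' ⟨a, ha⟩
    rw [← mul_assoc] at h4
    refine P.mem_of_orderOf_eq_pow h4 (k := k) ?_
    rw [mul_assoc, ← mul_assoc, orderOf_inv_mul_mul, ← hk, ← Subgroup.orderOf_coe]
  rw [eq_comm, QuotientGroup.eq, inv_one, one_mul]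
  refine (Subgroup.mem_normalizer_iff'' (H := (P : Subgroup G))).2 fun b => ⟨h1 b, fun hb => ?_⟩
  have hinj : Function.Injective (fun a : (P : Subgroup G) =>
      (⟨x⁻¹ * a * x, h1 a a.2⟩ : (P : Subgroup G))) := by
    intro a a' haa
    simpa using haa
  obtain ⟨a, ha⟩ := Finite.surjective_of_injective hinj ⟨_, hb⟩
  have : (a : G) = b := by simpa using ha
  exact this ▸ a.2

variable {A : Type*} [CommGroup A] {N : Subgroup G}

/-- The cocycle on `G ⧸ N` whose product over `G ⧸ N` is the transfer of `f`. -/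
noncomputable def transferCocycle (f : N →* A) (a : G) (q : G ⧸ N) : A :=
  f ⟨(a • q).out⁻¹ * (a * q.out), by
    rw [← QuotientGroup.eq, QuotientGroup.out_eq']
    conv_lhs => rw [← QuotientGroup.out_eq' q]
    rfl⟩

theorem transferCocycle_mul {G : Type*} [Group G] {N : Subgroup G} (f : N →* A) (a b : G) (q : G ⧸ N) :
    transferCocycle f (a * b) q = transferCocycle f a (b • q) * transferCocycle f b q := by
  unfold transferCocycle
  rw [← map_mul]
  congr 1
  apply Subtype.ext
  simp [mul_smul, mul_assoc]

theorem transferCocycle_of_smul_eq {G : Type*} [Group G] {N : Subgroup G} (f : N →* A) {a : G} {q : G ⧸ N} (h : a • q = q) :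
    ∃ hm : q.out⁻¹ * a * q.out ∈ N, transferCocycle f a q = f ⟨q.out⁻¹ * a * q.out, hm⟩ := by
  have h1 : (a • q).out⁻¹ * (a * q.out) ∈ N := by
    rw [← QuotientGroup.eq, QuotientGroup.out_eq']
    conv_lhs => rw [← QuotientGroup.out_eq' q]
    rfl
  rw [h, ← mul_assoc] at h1
  refine ⟨h1, ?_⟩
  unfold transferCocycle
  congr 1
  apply Subtype.ext
  simp [h, mul_assoc]

theorem prod_transferCocycle_eq_one [Fintype (G ⧸ N)] (hA : ∀ a : A, a ^ p = 1) (f : N →* A)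
    {u : G} (hu : u ∈ pResidual p G) : ∏ q : G ⧸ N, transferCocycle f u q = 1 := by
  have hAp : IsPGroup p A := fun a => ⟨1, by rw [pow_one, hA]⟩
  exact map_pResidual_eq_one hAp ((cocycleProd (transferCocycle_mul f) ⊤ Finset.univ
    (fun _ _ _ _ => Finset.mem_univ _)).comp (Subgroup.inclusion le_top)) ⟨u, hu⟩

theorem HasSmallPowerfulClass.map_eq_one_of_mem_sylow {P : Sylow p G}
    (h : HasSmallPowerfulClass p (P : Subgroup G)) (hA : ∀ a : A, a ^ p = 1)
    (f : Subgroup.normalizer (P : Set G) →* A) (u : Subgroup.normalizer (P : Set G))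
    (huP : (u : G) ∈ P) (hu : (u : G) ∈ pResidual p G) : f u = 1 := by
  classical
  induction hn : orderOf (u : G) using Nat.strong_induction_on generalizing u with
  | _ n ih =>
  subst hn
  let := Fintype.ofFinite (G ⧸ Subgroup.normalizer (P : Set G))
  set q₀ : G ⧸ Subgroup.normalizer (P : Set G) := QuotientGroup.mk (1 : G) with hq₀
  have htot := prod_transferCocycle_eq_one hA f hu
  rw [← Finset.mul_prod_erase _ _ (Finset.mem_univ q₀)] at htot
  have hrest : ∏ q ∈ Finset.univ.erase q₀, transferCocycle f (u : G) q = 1 := by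
    refine Finset.prod_cancels_of_partition_cancels
      (MulAction.orbitRel (P : Subgroup G) (G ⧸ Subgroup.normalizer (P : Set G))) fun x hx => ?_
    have hPq₀ : ∀ a : (P : Subgroup G), a • q₀ = q₀ := fun a =>
      QuotientGroup.eq.2 (by simpa using Subgroup.le_normalizer a.2)
    have hx' : x ≠ q₀ := Finset.ne_of_mem_erase hx
    refine HasSmallPowerfulClass.prod_cocycle_orbit_eq_one (H := (P : Subgroup G)) h P.isPGroup' hA
      (c := fun a q => transferCocycle f (a : G) q)
      (fun a b q => transferCocycle_mul f a b q) (P.stabilizer_quotient_normalizer_ne_top hx')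
      (u := ⟨u, huP⟩) ?_ ?_
    · intro y
      rw [Finset.mem_filter, Finset.mem_erase]
      refine ⟨fun hy => hy.2, fun hy => ⟨⟨?_, Finset.mem_univ _⟩, hy⟩⟩
      rintro rfl
      obtain ⟨a, ha⟩ := hy
      apply hx'
      rw [← hPq₀ a] at ha
      exact smul_left_cancel a ha
    · intro y _ hy
      set m := Function.minimalPeriod ((⟨u, huP⟩ : (P : Subgroup G)) • ·) y with hm
      have hfix : ((u : G) ^ m) • y = y := by
        have := Function.iterate_minimalPeriod (f := ((⟨u, huP⟩ : (P : Subgroup G)) • ·)) (x := y)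
        rw [smul_iterate] at this
        exact this
      have hdvd : m ∣ orderOf (u : G) := by
        refine Function.IsPeriodicPt.minimalPeriod_dvd ?_
        rw [Function.IsPeriodicPt, Function.IsFixedPt, smul_iterate]
        change ((u : G) ^ orderOf (u : G)) • y = y
        rw [pow_orderOf_eq_one, one_smul]
      have hm1 : m ≠ 1 := fun h1 => hy (Function.minimalPeriod_eq_one_iff_isFixedPt.1 h1)
      have hpos := orderOf_pos (u : G)
      have hm0 : m ≠ 0 := by
        rintro h0
        rw [h0, zero_dvd_iff] at hdvd
        omega
      obtain ⟨hmem, heq⟩ := transferCocycle_of_smul_eq f hfix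
      change transferCocycle f ((u : G) ^ m) y = 1
      rw [heq]
      have hord : orderOf (y.out⁻¹ * (u : G) ^ m * y.out) = orderOf (u : G) / m := by
        rw [orderOf_inv_mul_mul, orderOf_pow_of_dvd hm0 hdvd]
      obtain ⟨k, hk⟩ := IsPGroup.iff_orderOf.1 P.isPGroup' ⟨u, huP⟩
      rw [← Subgroup.orderOf_coe] at hk
      have hdiv : orderOf (u : G) / m ∣ p ^ k := by
        rw [← hk]
        exact Nat.div_dvd_of_dvd hdvd
      obtain ⟨j, _, hj⟩ := (Nat.dvd_prime_pow Fact.out).1 hdiv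
      -- The conjugate of `u ^ m` is a `p`-element of `N_G(P)`, hence in `P`; it is in `O^p(G)` by
      -- normality and has smaller order since `m > 1`.
      refine ih _ ?_ ⟨_, hmem⟩ (P.mem_of_orderOf_eq_pow hmem (hord.trans hj)) ?_ rfl
      · change orderOf (y.out⁻¹ * (u : G) ^ m * y.out) < _
        rw [hord]
        exact Nat.div_lt_self hpos (by omega)
      · simpa using pResidual_normal.conj_mem _ (pow_mem hu m) y.out⁻¹
  rw [hrest, mul_one] at htot
  have hout : q₀.out ∈ Subgroup.normalizer (P : Set G) := by
    have : (q₀.out : G ⧸ Subgroup.normalizer (P : Set G)) = QuotientGroup.mk (1 : G) := QuotientGroup.out_eq' q₀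
    rw [eq_comm, QuotientGroup.eq] at this
    simpa using this
  have hfix : (u : G) • q₀ = q₀ := QuotientGroup.eq.2 (by simp)
  obtain ⟨hmem, heq⟩ := transferCocycle_of_smul_eq f hfix
  rw [heq] at htot
  have : (⟨q₀.out⁻¹ * u * q₀.out, hmem⟩ : Subgroup.normalizer (P : Set G)) =
      (⟨q₀.out, hout⟩ : Subgroup.normalizer (P : Set G))⁻¹ * u * ⟨q₀.out, hout⟩ := rfl
  rw [this, map_mul, map_mul, map_inv, mul_comm, mul_inv_cancel_left] at htot
  exact htot

/-- Raising `u` to the `p'`-part of its order gives an element of `P`, and this power is invertible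
on `A`. -/
theorem HasSmallPowerfulClass.map_eq_one_of_mem_pResidual {P : Sylow p G}
    (h : HasSmallPowerfulClass p (P : Subgroup G)) (hA : ∀ a : A, a ^ p = 1)
    (f : Subgroup.normalizer (P : Set G) →* A) (u : Subgroup.normalizer (P : Set G))
    (hu : (u : G) ∈ pResidual p G) : f u = 1 := by
  have hAp : IsPGroup p A := fun a => ⟨1, by rw [pow_one, hA]⟩
  obtain ⟨k, m, hm, hkm⟩ := Nat.exists_eq_pow_mul_and_not_dvd (orderOf_pos (u : G)).ne' p
    (Fact.out : p.Prime).ne_one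
  have hm0 : m ≠ 0 := by rintro rfl; simp at hm
  refine hAp.eq_one_of_coprime (n := m) ((Nat.Prime.coprime_iff_not_dvd Fact.out).2 hm).symm ?_
  rw [← map_pow]
  refine h.map_eq_one_of_mem_sylow hA f _ ?_ (pow_mem hu m)
  refine P.mem_of_orderOf_eq_pow (k := k) (u ^ m).2 ?_
  rw [Subgroup.coe_pow, orderOf_pow_of_dvd hm0 (hkm ▸ dvd_mul_left _ _), hkm,
    Nat.mul_div_cancel _ (Nat.pos_of_ne_zero hm0)]

end Control

/-! ### From homomorphisms of exponent `p` to `O^p(N)` -/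

section Tate

open scoped IsMulCommutative

variable {p : ℕ} [Fact p.Prime] {G : Type*} [Group G] [Finite G]

/-- Let `K` be a normal subgroup of `G` without nontrivial homomorphisms to `C`, where `C` is a
central subgroup of `E`, and let `G = N K`. If `π : N →* E` maps `N ∩ K` to `C`, then the
`|G : N|`-th power of the restriction of `π` to `N ∩ K` extends to a homomorphism `N →* C`. -/
theorem exists_hom_eq_pow_index {K N : Subgroup G} [K.Normal] (hNK : N ⊔ K = ⊤) {E : Type*}
    [Group E] {C : Subgroup E} [IsMulCommutative C] (hC : C ≤ Subgroup.center E) (π : N →* E)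
    (hπ : ∀ n : N, (n : G) ∈ K → π n ∈ C) (hK : ∀ (f : K →* C) (x : K), f x = 1) :
    ∃ f : N →* C, ∀ (n : N) (hn : (n : G) ∈ K), f n = ⟨π n, hπ n hn⟩ ^ N.index := by
  -- The pairs `(n k, π n)` with `n ∈ N`, `k ∈ K`. As `N K = G`, this is an extension of `G`, with
  -- central kernel `π (N ∩ K)`.
  let Γ : Subgroup (G × E) :=
    { carrier := {q | ∃ n : N, π n = q.2 ∧ (n : G)⁻¹ * q.1 ∈ K}
      one_mem' := ⟨1, by simp, by simp⟩
      mul_mem' := by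
        rintro ⟨x, e⟩ ⟨x', e'⟩ ⟨n, rfl, hn⟩ ⟨n', rfl, hn'⟩
        refine ⟨n * n', map_mul _ _ _, ?_⟩
        have h1 := (inferInstance : K.Normal).conj_mem _ hn (n' : G)⁻¹
        have h2 := mul_mem h1 hn'
        simpa [mul_assoc] using h2
      inv_mem' := by
        rintro ⟨x, e⟩ ⟨n, rfl, hn⟩
        refine ⟨n⁻¹, map_inv _ _, ?_⟩
        have h1 := (inferInstance : K.Normal).conj_mem _ (inv_mem hn) (n : G)
        simpa [mul_assoc] using h1 }
  have hΓ : ∀ q : G × E, q ∈ Γ ↔ ∃ n : N, π n = q.2 ∧ (n : G)⁻¹ * q.1 ∈ K := fun _ => Iff.rfl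
  let fst : Γ →* G := (MonoidHom.fst G E).comp Γ.subtype
  have hfst : Function.Surjective fst := by
    intro x
    obtain ⟨n, hn, k, hk, rfl⟩ := Subgroup.mem_sup_of_normal_right.1
      (hNK ▸ Subgroup.mem_top x : x ∈ N ⊔ K)
    exact ⟨⟨(n * k, π ⟨n, hn⟩), (hΓ _).2 ⟨⟨n, hn⟩, rfl, by simpa using hk⟩⟩, rfl⟩
  let ρ : N.comap fst →* N := (fst.comp (N.comap fst).subtype).codRestrict N fun q => q.2
  let snd : N.comap fst →* E := ((MonoidHom.snd G E).comp Γ.subtype).comp (N.comap fst).subtype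
  have hmem : ∀ q : N.comap fst, (π (ρ q))⁻¹ * snd q ∈ C := by
    intro q
    obtain ⟨n, he, hn⟩ := (hΓ _).1 q.1.2
    change (π (ρ q))⁻¹ * (q : Γ).1.2 ∈ C
    rw [← he, ← map_inv, ← map_mul]
    apply hπ
    have h1 := inv_mem hn
    rw [mul_inv_rev, inv_inv] at h1
    exact h1
  -- Over `N` the extension is split by the graph of `π`; `φ` is the resulting projection,
  -- multiplicative because `C` is central. Its transfer to `Γ`, restricted to the graph, is the
  -- required map.
  let φ : N.comap fst →* C := MonoidHom.mk' (fun q => ⟨(π (ρ q))⁻¹ * snd q, hmem q⟩) fun a b => by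
    apply Subtype.ext
    have hc := Subgroup.mem_center_iff.1 (hC (hmem a)) (π (ρ b))⁻¹
    simp only [map_mul, mul_inv_rev, Subgroup.coe_mul]
    rw [← mul_assoc _ (π (ρ b))⁻¹, ← hc]
    simp only [mul_assoc]
  have hidx : (N.comap fst).index = N.index := Subgroup.index_comap_of_surjective N hfst
  have hfin : (N.comap fst).FiniteIndex := ⟨by rw [hidx]; exact Subgroup.index_ne_zero_of_finite⟩
  let diag : N →* Γ := (N.subtype.prod π).codRestrict Γ fun n => (hΓ _).2 ⟨n, rfl, by simp⟩
  let incl : K →* Γ := (K.subtype.prod 1).codRestrict Γ fun k =>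
    (hΓ _).2 ⟨1, by simp, by simp⟩
  let τ : Γ →* C := MonoidHom.transfer (A := C) φ
  refine ⟨τ.comp diag, fun n hn => ?_⟩
  have hz : ((1, π n) : G × E) ∈ Γ := (hΓ _).2 ⟨n, rfl, by simpa using hn⟩
  -- The transfer kills the first factor, which comes from `K`, and raises the central second factor
  -- to the index.
  have hdiag : diag n = incl ⟨n, hn⟩ * ⟨(1, π n), hz⟩ := by
    apply Subtype.ext
    simp [diag, incl]
  have hcentral : ∀ (k : ℕ) (g : Γ), g⁻¹ * (⟨(1, π n), hz⟩ : Γ) ^ k * g = ⟨(1, π n), hz⟩ ^ k := by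
    intro k g
    have hc := Subgroup.mem_center_iff.1 (pow_mem (hC (hπ n hn)) k) g.1.2
    rw [mul_assoc, inv_mul_eq_iff_eq_mul]
    apply Subtype.ext
    simp only [Subgroup.coe_mul, Subgroup.coe_pow]
    ext
    · simp
    · simpa using hc.symm
  rw [MonoidHom.comp_apply, hdiag, map_mul]
  have h1 : τ (incl ⟨n, hn⟩) = 1 := hK (τ.comp incl) ⟨n, hn⟩
  have hzN : (⟨(1, π n), hz⟩ : Γ) ∈ N.comap fst := one_mem N
  have h2 : τ ⟨(1, π n), hz⟩ = φ ⟨_, hzN⟩ ^ N.index := by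
    rw [← hidx, ← map_pow]
    exact MonoidHom.transfer_eq_pow (A := C) φ _ fun k g _ => hcentral k g
  have h3 : φ ⟨_, hzN⟩ = ⟨π n, hπ n hn⟩ := by
    apply Subtype.ext
    change (π 1)⁻¹ * π n = π n
    rw [map_one, inv_one, one_mul]
  rw [h1, one_mul, h2, h3]

/-- A nontrivial normal subgroup of a finite `p`-group contains a central element of order `p`. -/
theorem IsPGroup.exists_mem_center_of_normal {E : Type*} [Group E] [Finite E] (hE : IsPGroup p E)
    {B : Subgroup E} [B.Normal] (hB : B ≠ ⊥) :
    ∃ z ∈ B, z ∈ Subgroup.center E ∧ z ^ p = 1 ∧ z ≠ 1 := by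
  have hc : IsPGroup p (ConjAct E) := hE.of_equiv ConjAct.toConjAct
  have hnt : Nontrivial B := B.nontrivial_iff_ne_bot.2 hB
  obtain ⟨a, ha, hBa⟩ := (hE.to_subgroup B).nontrivial_iff_card.1 hnt
  obtain ⟨b, hb, hb1⟩ := hc.exists_fixed_point_of_prime_dvd_card_of_fixed_point B
    (hBa ▸ dvd_pow_self p ha.ne') (a := 1) (fun g => smul_one g)
  have hbc : (b : E) ∈ Subgroup.center E := by
    refine Subgroup.mem_center_iff.2 fun g => ?_
    have h1 := congrArg Subtype.val (hb (ConjAct.toConjAct g))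
    rw [ConjAct.Subgroup.val_conj_smul, ConjAct.toConjAct_smul, mul_inv_eq_iff_eq_mul] at h1
    exact h1
  obtain ⟨k, hk⟩ := IsPGroup.iff_orderOf.1 hE b
  have hb1' : (b : E) ≠ 1 := fun h => hb1 (Subtype.ext h.symm)
  have hk0 : k ≠ 0 := by
    rintro rfl
    exact hb1' (orderOf_eq_one_iff.1 (by simpa using hk))
  have hp : p.Prime := Fact.out
  refine ⟨(b : E) ^ p ^ (k - 1), pow_mem b.2 _, pow_mem hbc _, ?_, ?_⟩
  · rw [← pow_mul, pow_sub_one_mul hk0, ← hk, pow_orderOf_eq_one]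
  · intro h
    have h1 := orderOf_dvd_of_pow_eq_one h
    rw [hk, Nat.pow_dvd_pow_iff_le_right hp.one_lt] at h1
    omega

/-- The index divides both a power of `p` and `|G : P|`. -/
theorem Sylow.normalizer_sup_pResidual (P : Sylow p G) :
    Subgroup.normalizer (P : Set G) ⊔ pResidual p G = ⊤ := by
  obtain ⟨k, hk⟩ := IsPGroup.iff_card.1 (isPGroup_quotient_pResidual (p := p) (G := G))
  have h1 : (Subgroup.normalizer (P : Set G) ⊔ pResidual p G).index ∣ p ^ k :=
    hk ▸ Subgroup.index_dvd_of_le le_sup_right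
  have h2 : (Subgroup.normalizer (P : Set G) ⊔ pResidual p G).index ∣ (P : Subgroup G).index :=
    Subgroup.index_dvd_of_le (Subgroup.le_normalizer.trans le_sup_left)
  obtain ⟨j, _, hj⟩ := (Nat.dvd_prime_pow Fact.out).1 h1
  rw [← Subgroup.index_eq_one, hj]
  rw [hj] at h2
  rcases Nat.eq_zero_or_pos j with rfl | hj0
  · simp
  · exact absurd ((dvd_pow_self p hj0.ne').trans h2) P.not_dvd_index

theorem coe_mem_pResidual {N : Subgroup G} {n : N} (hn : n ∈ pResidual p N) :
    (n : G) ∈ pResidual p G := by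
  have h : pResidual p N ≤ (pResidual p G).comap N.subtype := by
    rw [pResidual_eq_closure (G := N)]
    refine (Subgroup.closure_le _).2 fun x hx => mem_pResidual_of_coprime ?_
    rw [Subgroup.coe_subtype, Subgroup.orderOf_coe]
    exact hx
  exact h hn

theorem HasSmallPowerfulClass.mem_pResidual_normalizer {P : Sylow p G}
    (h : HasSmallPowerfulClass p (P : Subgroup G)) {n : Subgroup.normalizer (P : Set G)}
    (hn : (n : G) ∈ pResidual p G) : n ∈ pResidual p (Subgroup.normalizer (P : Set G)) := by
  set D : Subgroup (Subgroup.normalizer (P : Set G)) :=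
    (pResidual p G).comap (Subgroup.normalizer (P : Set G)).subtype with hD
  suffices hDM : D ≤ pResidual p (Subgroup.normalizer (P : Set G)) from hDM hn
  by_contra hDM
  -- By maximality of `L`, the quotient `D / L` will be central of order `p` in the `p`-group `N /
  -- L`.
  obtain ⟨L, ⟨hLn, hML, hLD⟩, hmax⟩ := (Set.toFinite {L : Subgroup (Subgroup.normalizer (P : Set G)) |
    L.Normal ∧ pResidual p (Subgroup.normalizer (P : Set G)) ≤ L ∧ L < D}).exists_maximal
      ⟨pResidual p _, inferInstance, le_rfl, lt_of_le_not_ge (fun _ => coe_mem_pResidual) hDM⟩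
  have hE : IsPGroup p (Subgroup.normalizer (P : Set G) ⧸ L) :=
    isPGroup_quotient_of_coprime_mem fun x hx => hML (mem_pResidual_of_coprime hx)
  set mk := QuotientGroup.mk' L with hmk
  have hker : mk.ker = L := QuotientGroup.ker_mk' L
  have hDn : (D.map mk).Normal :=
    Subgroup.Normal.map inferInstance mk (QuotientGroup.mk'_surjective L)
  have hDbot : D.map mk ≠ ⊥ := by
    rw [Ne, Subgroup.map_eq_bot_iff, hker]
    exact hLD.not_ge
  obtain ⟨z, hzD, hzc, hzp, hz1⟩ := hE.exists_mem_center_of_normal hDbot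
  have hzC : Subgroup.zpowers z ≤ Subgroup.center _ := by simpa using hzc
  have hzn : ((Subgroup.zpowers z).comap mk).Normal := by
    refine Subgroup.Normal.comap ⟨fun a ha g => ?_⟩ mk
    rw [Subgroup.mem_center_iff.1 (hzC ha) g, mul_inv_cancel_right]
    exact ha
  have hzle : (Subgroup.zpowers z).comap mk ≤ D := by
    have h1 : Subgroup.zpowers z ≤ D.map mk := by simpa using hzD
    have h2 := Subgroup.comap_mono (f := mk) h1
    rwa [Subgroup.comap_map_eq_self (hker.trans_le hLD.le)] at h2
  have hLz : L ≤ (Subgroup.zpowers z).comap mk := hker.symm.trans_le (Subgroup.ker_le_comap _ _)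
  have hDz : D ≤ (Subgroup.zpowers z).comap mk := by
    by_contra hnot
    have h1 := hmax ⟨hzn, hML.trans hLz, lt_of_le_not_ge hzle hnot⟩ hLz
    obtain ⟨w, hw⟩ := QuotientGroup.mk'_surjective L z
    have h2 : w ∈ L := h1 (by
      rw [Subgroup.mem_comap, hmk, hw]
      exact Subgroup.mem_zpowers z)
    exact hz1 (hw ▸ (QuotientGroup.eq_one_iff w).2 h2)
  have hexp : ∀ a : Subgroup.zpowers z, a ^ p = 1 := by
    rintro ⟨_, j, rfl⟩
    apply Subtype.ext
    change (z ^ j) ^ p = 1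
    rw [← zpow_natCast, zpow_comm, zpow_natCast, hzp, one_zpow]
  have hzp' : IsPGroup p (Subgroup.zpowers z) := hE.to_subgroup _
  obtain ⟨f, hf⟩ := exists_hom_eq_pow_index P.normalizer_sup_pResidual hzC mk
    (fun n hn => hDz hn) (fun f x => map_pResidual_eq_one hzp' f x)
  -- On `D`, `f` is both trivial and the `|G : N|`-th power of the quotient map; the index is prime
  -- to `p`, so `D ≤ L`.
  refine hLD.not_ge fun x hx => ?_
  have h1 := (h.map_eq_one_of_mem_pResidual (A := Subgroup.zpowers z) hexp f x hx).symm.trans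
    (hf x hx)
  have h2 := hzp'.eq_one_of_coprime (n := (Subgroup.normalizer (P : Set G)).index) ?_ h1.symm
  · exact (QuotientGroup.eq_one_iff x).1 (congrArg Subtype.val h2)
  · refine ((Nat.Prime.coprime_iff_not_dvd Fact.out).2 fun hdvd => ?_).symm
    exact P.not_dvd_index (hdvd.trans (Subgroup.index_dvd_of_le Subgroup.le_normalizer))

/-- The image of `O^p(G)` in an abelian group consists of elements of order prime to `p`. -/
theorem exists_coprime_map_pow_eq_one {A : Type*} [CommGroup A] (f : G →* A) {x : G}
    (hx : x ∈ pResidual p G) : ∃ m : ℕ, m.Coprime p ∧ f x ^ m = 1 := by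
  rw [pResidual_eq_closure] at hx
  induction hx using Subgroup.closure_induction with
  | mem x hx => exact ⟨orderOf x, hx, by rw [← map_pow, pow_orderOf_eq_one, map_one]⟩
  | one => exact ⟨1, Nat.coprime_one_left p, by simp⟩
  | mul x y _ _ hx hy =>
    obtain ⟨m, hm, hxm⟩ := hx
    obtain ⟨n, hn, hyn⟩ := hy
    refine ⟨m * n, hm.mul_left hn, ?_⟩
    rw [map_mul, mul_pow, pow_mul, hxm, one_pow, mul_comm m, pow_mul, hyn, one_pow, one_mul]
  | inv x _ hx =>
    obtain ⟨m, hm, hxm⟩ := hx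
    exact ⟨m, hm, by rw [map_inv, inv_pow, hxm, inv_one]⟩

theorem commutator_top_le_sup {G : Type*} [Group G] {N K : Subgroup G} [K.Normal] (hNK : N ⊔ K = ⊤) :
    ⁅(⊤ : Subgroup G), ⊤⁆ ≤ ⁅N, N⁆ ⊔ K := by
  have h1 : (⊤ : Subgroup G).map (QuotientGroup.mk' K) = N.map (QuotientGroup.mk' K) := by
    rw [← hNK, Subgroup.map_sup, QuotientGroup.map_mk'_self, sup_bot_eq]
  have h2 : Subgroup.map (QuotientGroup.mk' K) ⁅(⊤ : Subgroup G), ⊤⁆ ≤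
      Subgroup.map (QuotientGroup.mk' K) ⁅N, N⁆ := by
    rw [Subgroup.map_commutator, Subgroup.map_commutator, h1]
  rwa [Subgroup.map_le_iff_le_comap, Subgroup.comap_map_eq, QuotientGroup.ker_mk'] at h2

end Tate

/-- If a Sylow `p`-subgroup `P` of a finite group `G` has small powerful class, then `N = N_G(P)`
controls transfer in `G`. Control of transfer is stated in both of its usual forms,
`P ∩ G' = P ∩ N'` and `O^p(N) = N ∩ O^p(G)`. -/
theorem proposition3p2 {G : Type*} [Group G] [Finite G] {p : ℕ} [Fact p.Prime] (P : Sylow p G)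
    (hP : HasSmallPowerfulClass p (P : Subgroup G)) :
    ControlsTransfer P (Subgroup.normalizer (P : Set G)) ∧
      (pResidual p (Subgroup.normalizer (P : Set G))).map
          (Subgroup.normalizer (P : Set G)).subtype =
        Subgroup.normalizer (P : Set G) ⊓ pResidual p G := by
  have hPN : (P : Subgroup G) ≤ Subgroup.normalizer (P : Set G) := Subgroup.le_normalizer
  refine ⟨⟨hPN, le_antisymm (le_inf inf_le_left ?_)
    (inf_le_inf_left _ (Subgroup.commutator_mono le_top le_top))⟩, le_antisymm ?_ ?_⟩
  · rintro x ⟨hxP, hx⟩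
    obtain ⟨n, hn, k, hk, rfl⟩ := Subgroup.mem_sup_of_normal_right.1
      (commutator_top_le_sup P.normalizer_sup_pResidual hx)
    rw [← Subgroup.map_subtype_commutator] at hn ⊢
    obtain ⟨n, hn, rfl⟩ := hn
    have hkN : k ∈ Subgroup.normalizer (P : Set G) :=
      (Subgroup.mul_mem_cancel_left _ n.2).1 (hPN hxP)
    -- In `N / N'` the elements `k` and `n k` have the same image, of order prime to `p` since `k ∈
    -- O^p(N)` and a power of `p` since `n k ∈ P`.
    obtain ⟨m, hm, hkm⟩ := exists_coprime_map_pow_eq_one Abelianization.of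
      (hP.mem_pResidual_normalizer (n := ⟨k, hkN⟩) hk)
    refine ⟨n * ⟨k, hkN⟩, mul_mem hn ?_, rfl⟩
    obtain ⟨j, hj⟩ := IsPGroup.iff_orderOf.1 P.isPGroup' ⟨_, hxP⟩
    have hof : Abelianization.of n = 1 := by
      rwa [← MonoidHom.mem_ker, Abelianization.ker_of]
    have hpow : Abelianization.of (⟨k, hkN⟩ : Subgroup.normalizer (P : Set G)) ^ p ^ j = 1 := by
      have h1 : (n * ⟨k, hkN⟩ : Subgroup.normalizer (P : Set G)) ^ p ^ j = 1 := by
        apply Subtype.ext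
        have h2 := pow_orderOf_eq_one (⟨_, hxP⟩ : (P : Subgroup G))
        rw [hj] at h2
        exact congrArg (fun y : (P : Subgroup G) => (y : G)) h2
      rw [← map_one Abelianization.of, ← h1, map_pow, map_mul, hof, one_mul]
    have h3 : orderOf (Abelianization.of (⟨k, hkN⟩ : Subgroup.normalizer (P : Set G))) ∣ 1 := by
      rw [← Nat.Coprime.gcd_eq_one (hm.pow_right j)]
      exact Nat.dvd_gcd (orderOf_dvd_of_pow_eq_one hkm) (orderOf_dvd_of_pow_eq_one hpow)
    rw [Nat.dvd_one, orderOf_eq_one_iff, ← MonoidHom.mem_ker, Abelianization.ker_of] at h3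
    exact h3
  · rintro _ ⟨n, hn, rfl⟩
    exact ⟨n.2, coe_mem_pResidual hn⟩
  · rintro x ⟨hxN, hx⟩
    exact ⟨⟨x, hxN⟩, hP.mem_pResidual_normalizer hx, rfl⟩
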